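/- Let $n\ge 1$, let $A_1,\dots,A_n\in\mathbb{C}[X_1,\dots,X_n]$ and $D=\sum_{i=1}^n A_i\,\partial_{X_i}$. A polynomial $f$ is a Darboux polynomial of $D$ if $D(f)=g f$ for some polynomial $g$; Darboux polynomials are counted as families of nonconstant, pairwise coprime ones (for instance irreducible and pairwise non-associate ones). The Newton polytope $\mathcal N(h)\subset\mathbb{R}^n$ of a Laurent polynomial $h$ is the convex hull of the exponents of its nonzero terms. There is a unique set $N_D\subset\mathbb{R}^n$ such that $\mathcal N\big(\sum_{i} x_i A_i/X_i\big)=N_D$ for generic $(x_1,\dots,x_n)\in\mathbb{C}^n$, that is, for all $x$ outside the zero set of some nonzero polynomial. Let $B$ be the number of points of $N_D\cap\mathbb{N}^n$, where $0\in\mathbb N$. (1) If $f_1,\dots,f_m$ are nonconstant, pairwise coprime Darboux polynomials of $D$ and $m\ge B+1$, then there are $\lambda_1,\dots,\lambda_m\in\mathbb{C}$ such that $\prod_i f_i^{\lambda_i}$ is a Darboux first integral of $D$: every branch $F=\exp(\sum_i\lambda_i L_i)$, where $L_i$ is a holomorphic branch of $\log f_i$ on a nonempty open set $U\subset\mathbb{C}^n$,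 is nonconstant on $U$ and satisfies $\sum_j A_j\,\partial F/\partial X_j=0$ on $U$ (and such branches exist). (2) If $D$ has $m\ge B+n$ nonconstant, pairwise coprime Darboux polynomials, then $D$ has a rational first integral: a nonconstant $F\in\mathbb{C}(X_1,\dots,X_n)$ with $D(F)=0$. The bound $B+n$ in (2) is optimal. Let $d\ge 1$, let $p\in\mathbb{C}[X_1]$ have degree $d$ and $d$ distinct roots, let $\alpha$ be a root of $p$, and let $\xi_2,\dots,\xi_n\in\mathbb{C}$ be such that $p'(\alpha),\xi_2,\dots,\xi_n$ are linearly independent over $\mathbb{Z}$; for all $n\geq 1$ and $d\ge1$ such $p,\alpha,\xi_2,\dots,\xi_n$ exist. Then $D=p(X_1)\partial_{X_1}+\sum_{i=2}^n\xi_iX_i\,\partial_{X_i}$ has $B=d$, it has $B+n-1$ irreducible, pairwise coprime Darboux polynomials, and it has no rational first integral. -/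

import Mathlib

noncomputable section

namespace SparseDarboux

/-- The derivation `∑ i, A i ∂/∂X_i` of `ℂ[X_1, …, X_n]`. -/
def polyDerivation {n : ℕ} (A : Fin n → MvPolynomial (Fin n) ℂ) :
    Derivation ℂ (MvPolynomial (Fin n) ℂ) (MvPolynomial (Fin n) ℂ) :=
  ∑ i, A i • MvPolynomial.pderiv i

theorem polyDerivation_apply {n : ℕ} (A : Fin n → MvPolynomial (Fin n) ℂ)
    (f : MvPolynomial (Fin n) ℂ) :
    polyDerivation A f = ∑ i, A i * MvPolynomial.pderiv i f := by
  have h := map_sum (Derivation.coeFnAddMonoidHom (R := ℂ) (A := MvPolynomial (Fin n) ℂ)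
    (M := MvPolynomial (Fin n) ℂ)) (fun i => A i • MvPolynomial.pderiv i) Finset.univ
  have h2 := congrFun h f
  rw [Finset.sum_apply] at h2
  exact h2

/-! ### Laurent polynomials and Newton polytopes -/

/-- Laurent polynomials `ℂ[X_1^{±1}, …, X_n^{±1}]`. -/
abbrev Laurent (n : ℕ) : Type := AddMonoidAlgebra ℂ (Fin n → ℤ)

/-- The inclusion of polynomials in Laurent polynomials, `X_i ↦ X^{e_i}`. -/
def toLaurent (n : ℕ) : MvPolynomial (Fin n) ℂ →ₐ[ℂ] Laurent n :=
  MvPolynomial.aeval fun i => AddMonoidAlgebra.single (Pi.single i (1 : ℤ)) (1 : ℂ)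

/-- The Laurent monomial `X_i⁻¹`. -/
def invX {n : ℕ} (i : Fin n) : Laurent n :=
  AddMonoidAlgebra.single (Pi.single i (-1 : ℤ)) (1 : ℂ)

/-- The Newton polytope of a Laurent polynomial: the convex hull in `ℝⁿ` of the exponents of its
nonzero terms. -/
def newtonPolytope {n : ℕ} (f : Laurent n) : Set (Fin n → ℝ) :=
  convexHull ℝ ((fun (m : Fin n → ℤ) (i : Fin n) => (m i : ℝ)) '' {m | f.coeff m ≠ 0})

/-- The Laurent polynomial `∑ i, x_i A_i / X_i`. -/
def laurentSum {n : ℕ} (A : Fin n → MvPolynomial (Fin n) ℂ) (x : Fin n → ℂ) : Laurent n :=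
  ∑ i, x i • (toLaurent n (A i) * invX i)

/-- `N` is the Newton polytope of `∑ i, x_i A_i / X_i` for generic `x`, that is, for all `x` outside
the zero set of some nonzero polynomial. At most one `N` has this property. -/
def IsGenericNewtonPolytope {n : ℕ} (A : Fin n → MvPolynomial (Fin n) ℂ)
    (N : Set (Fin n → ℝ)) : Prop :=
  ∃ G : MvPolynomial (Fin n) ℂ, G ≠ 0 ∧
    ∀ x : Fin n → ℂ, MvPolynomial.eval x G ≠ 0 → newtonPolytope (laurentSum A x) = N

/-- The number of points of `N ∩ ℕⁿ`. -/
def natPointCount {n : ℕ} (N : Set (Fin n → ℝ)) : ℕ :=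
  Set.ncard {m : Fin n → ℕ | (fun i => (m i : ℝ)) ∈ N}

/-! ### Darboux polynomials -/

/-- `f` is a Darboux polynomial of `D`: `D f = g f` for some polynomial `g`, the cofactor. -/
def IsDarbouxPolynomial {n : ℕ}
    (D : Derivation ℂ (MvPolynomial (Fin n) ℂ) (MvPolynomial (Fin n) ℂ))
    (f : MvPolynomial (Fin n) ℂ) : Prop :=
  ∃ g : MvPolynomial (Fin n) ℂ, D f = g * f

/-- A family of nonconstant, pairwise coprime Darboux polynomials. -/
structure IsDarbouxFamily {n m : ℕ}
    (D : Derivation ℂ (MvPolynomial (Fin n) ℂ) (MvPolynomial (Fin n) ℂ))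
    (f : Fin m → MvPolynomial (Fin n) ℂ) : Prop where
  darboux : ∀ i, IsDarbouxPolynomial D (f i)
  nonconstant : ∀ i, ∀ c : ℂ, f i ≠ MvPolynomial.C c
  coprime : ∀ i j, i ≠ j → IsRelPrime (f i) (f j)

/-! ### Darboux first integrals -/

/-- `L` is a family of holomorphic branches of `log f_i` on the nonempty open set `U ⊆ ℂⁿ`. -/
structure IsLogBranch {n m : ℕ} (f : Fin m → MvPolynomial (Fin n) ℂ)
    (U : Set (Fin n → ℂ)) (L : Fin m → (Fin n → ℂ) → ℂ) : Prop where
  isOpen : IsOpen U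
  nonempty : U.Nonempty
  holomorphic : ∀ i, DifferentiableOn ℂ (L i) U
  exp_eq : ∀ i, ∀ x ∈ U, Complex.exp (L i x) = MvPolynomial.eval x (f i)

/-- The branch `exp (∑ λ_i log f_i)` of `∏ f_i ^ λ_i` given by branches `L i` of `log f_i`. -/
def cpowProd {n m : ℕ} (lam : Fin m → ℂ) (L : Fin m → (Fin n → ℂ) → ℂ) (x : Fin n → ℂ) : ℂ :=
  Complex.exp (∑ i, lam i * L i x)

/-- The multivalued function `∏ f_i ^ λ_i` is a first integral of `∑ A_j ∂/∂X_j`: it has branches,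
and every branch of it on a nonempty open set is nonconstant and annihilated by the derivation. -/
def IsDarbouxFirstIntegral {n m : ℕ} (A : Fin n → MvPolynomial (Fin n) ℂ)
    (f : Fin m → MvPolynomial (Fin n) ℂ) (lam : Fin m → ℂ) : Prop :=
  (∃ U L, IsLogBranch f U L) ∧
    ∀ U L, IsLogBranch f U L →
      (¬ ∃ c : ℂ, ∀ x ∈ U, cpowProd lam L x = c) ∧
      ∀ x ∈ U, ∑ j, MvPolynomial.eval x (A j) *
        fderiv ℂ (cpowProd lam L) x (Pi.single j (1 : ℂ)) = 0

/-! ### Rational first integrals -/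

/-- The field `ℂ(X_1, …, X_n)` of rational functions. -/
abbrev RatFun (n : ℕ) : Type := FractionRing (MvPolynomial (Fin n) ℂ)

/-- The extension of `D` to `ℂ(X_1, …, X_n)`: `D(P/Q) = (D(P) Q - P D(Q)) / Q²`, for a chosen
representation of the rational function as `P/Q`; the lemma `extend_div` shows that
the formula holds for every representation. -/
def extend {n : ℕ} (D : Derivation ℂ (MvPolynomial (Fin n) ℂ) (MvPolynomial (Fin n) ℂ))
    (F : RatFun n) : RatFun n :=
  let P : MvPolynomial (Fin n) ℂ :=
    (IsLocalization.sec (nonZeroDivisors (MvPolynomial (Fin n) ℂ)) F).1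
  let Q : MvPolynomial (Fin n) ℂ :=
    (IsLocalization.sec (nonZeroDivisors (MvPolynomial (Fin n) ℂ)) F).2
  algebraMap _ (RatFun n) (D P * Q - P * D Q) / algebraMap _ (RatFun n) Q ^ 2

theorem extend_div {n : ℕ}
    (D : Derivation ℂ (MvPolynomial (Fin n) ℂ) (MvPolynomial (Fin n) ℂ))
    (P Q : MvPolynomial (Fin n) ℂ) (hQ : Q ≠ 0) :
    extend D (algebraMap _ (RatFun n) P / algebraMap _ (RatFun n) Q) =
      algebraMap _ (RatFun n) (D P * Q - P * D Q) / algebraMap _ (RatFun n) Q ^ 2 := by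
  have inj : Function.Injective (algebraMap (MvPolynomial (Fin n) ℂ) (RatFun n)) :=
    IsFractionRing.injective _ _
  have hQ' : algebraMap _ (RatFun n) Q ≠ 0 := by
    simpa using hQ
  set F := algebraMap _ (RatFun n) P / algebraMap _ (RatFun n) Q with hF
  have hs := IsLocalization.sec_spec (nonZeroDivisors (MvPolynomial (Fin n) ℂ)) F
  unfold extend
  set s := IsLocalization.sec (nonZeroDivisors (MvPolynomial (Fin n) ℂ)) F
  obtain ⟨p, q, hq⟩ := s
  have hq0 : q ≠ 0 := nonZeroDivisors.ne_zero hq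
  have hq' : algebraMap _ (RatFun n) q ≠ 0 := by
    simpa using hq0
  simp only at hs ⊢
  have e : P * q = p * Q := by
    apply inj
    rw [map_mul, map_mul, ← hs, hF]
    field_simp
  have de : P * D q + q * D P = p * D Q + Q * D p := by
    have := congrArg D e
    simpa using this
  rw [div_eq_div_iff (pow_ne_zero 2 hq') (pow_ne_zero 2 hQ'), ← map_pow, ← map_pow, ← map_mul,
    ← map_mul]
  congr 1
  linear_combination (-Q * q) * de + (Q * D q + q * D Q) * e

/-- A rational first integral of `D`: a nonconstant rational function `F` with `D F = 0`. -/
def IsRationalFirstIntegral {n : ℕ}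
    (D : Derivation ℂ (MvPolynomial (Fin n) ℂ) (MvPolynomial (Fin n) ℂ))
    (F : RatFun n) : Prop :=
  (∀ c : ℂ, F ≠ algebraMap (MvPolynomial (Fin n) ℂ) (RatFun n) (MvPolynomial.C c)) ∧ extend D F = 0

/-! ### The extremal derivations -/

/-- The coefficients of `p(X_1) ∂/∂X_1 + ∑_{i ≥ 2} ξ_i X_i ∂/∂X_i`; the variable `X_1` has
index `0`, and the value `ξ 0` plays no role. -/
def extremalField {n : ℕ} [NeZero n] (p : Polynomial ℂ) (ξ : Fin n → ℂ) (i : Fin n) :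
    MvPolynomial (Fin n) ℂ :=
  if i = 0 then Polynomial.aeval (MvPolynomial.X 0) p else MvPolynomial.C (ξ i) * MvPolynomial.X i

/-- `p` has degree `d` and `d` distinct roots, and `α` is a root of `p` such that
`p'(α), ξ_2, …, ξ_n` are linearly independent over `ℤ`. -/
structure IsExtremalData {n : ℕ} [NeZero n] (d : ℕ) (p : Polynomial ℂ) (α : ℂ)
    (ξ : Fin n → ℂ) : Prop where
  degree_eq : p.degree = d
  card_roots : p.roots.toFinset.card = d
  isRoot : p.IsRoot α
  indep : LinearIndependent ℤ
    (fun i : Fin n => if i = 0 then p.derivative.eval α else ξ i)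

end SparseDarboux

end

/-! Write `D = ∑ (A_i / X_i) · X_i ∂_i`. The operators `X_i ∂_i` create no new monomials, so the
Newton polytope of `D f` lies in `N_D + 𝒩(f)`. If `D f = g f`, it is also `𝒩(g) + 𝒩(f)`, and
cancelling `𝒩(f)` places `𝒩(g)` inside `N_D` (`cofactor_support`). All cofactors thus lie in a space
of dimension `B`, and `B + r` of them satisfy at least `r` independent relations `∑ λ_i g_i = 0`
(`le_finrank_ker_relationMap`).

A relation gives the closed form `ω = ∑ λ_i df_i / f_i`, which vanishes on `D` and, for `λ ≠ 0`, is
nonzero because the `f_i` are nonconstant and coprime (`logForm_injective`). The exponential of its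
primitive is the Darboux first integral of (1).

For (2), the Lie derivative of each `ω` along `D` is zero, so the `n` forms coming from `n`
relations solve one linear differential system. If `D` had no rational first integral, its field of
constants would be `ℂ`, and solutions independent over `ℂ` would stay independent over `ℂ(X)`
(`linearIndependent_of_solutions`). But the forms killed by `D ≠ 0` fill only a hyperplane.

For optimality, moving `α` to the origin gives `∑ X_i R_i ∂_i` with `R_i(0) = p'(α), ξ_2, …, ξ_n`.
On lowest terms in the first variable this acts diagonally, with eigenvalues that separate monomials
by the independence over `ℤ`. Hence `D P · Q = P · D Q` forces `P` to be a constant multiple of `Q`.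
-/

namespace SparseDarboux

open MvPolynomial

variable {n m : ℕ}

/-! ### Leading exponents -/

/-- Integer exponents, seen as real vectors. -/
def realVec (s : Fin n → ℤ) : Fin n → ℝ := fun i => (s i : ℝ)

/-- Exponents of monomials, seen as integer vectors. -/
def intVec (m : Fin n →₀ ℕ) : Fin n → ℤ := fun i => (m i : ℤ)

theorem realVec_add (s t : Fin n → ℤ) : realVec (s + t) = realVec s + realVec t := by
  ext i; simp [realVec]

theorem intVec_add (s t : Fin n →₀ ℕ) : intVec (s + t) = intVec s + intVec t := by
  ext i; simp [intVec]

theorem intVec_injective : Function.Injective (intVec (n := n)) := by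
  intro s t h
  ext i
  have := congrFun h i
  simpa [intVec] using this

/-- The weight of an exponent for a linear form, ties being broken lexicographically. -/
def weight (l : (Fin n → ℝ) →ₗ[ℝ] ℝ) (m : Fin n →₀ ℕ) : ℝ ×ₗ Lex (Fin n → ℤ) :=
  toLex (l (realVec (intVec m)), toLex (intVec m))

theorem weight_add (l : (Fin n → ℝ) →ₗ[ℝ] ℝ) (s t : Fin n →₀ ℕ) :
    weight l (s + t) = weight l s + weight l t := by
  simp only [weight, intVec_add, realVec_add, map_add]
  rfl

theorem weight_injective (l : (Fin n → ℝ) →ₗ[ℝ] ℝ) : Function.Injective (weight l) := by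
  intro s t h
  have h' : (l (realVec (intVec s)), toLex (intVec s)) =
      (l (realVec (intVec t)), toLex (intVec t)) :=
    toLex.injective h
  exact intVec_injective (toLex.injective (Prod.ext_iff.mp h').2)

theorem apply_le_of_weight_le {l : (Fin n → ℝ) →ₗ[ℝ] ℝ} {s t : Fin n →₀ ℕ}
    (h : weight l s ≤ weight l t) : l (realVec (intVec s)) ≤ l (realVec (intVec t)) :=
  Prod.Lex.monotone_fst _ _ h

theorem weight_le_of_apply_lt {l : (Fin n → ℝ) →ₗ[ℝ] ℝ} {s t : Fin n →₀ ℕ}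
    (h : l (realVec (intVec s)) < l (realVec (intVec t))) : weight l s ≤ weight l t :=
  Prod.Lex.toLex_le_toLex.mpr (Or.inl h)

theorem exists_leading (l : (Fin n → ℝ) →ₗ[ℝ] ℝ) {f : MvPolynomial (Fin n) ℂ} (hf : f ≠ 0) :
    ∃ a ∈ f.support, ∀ s ∈ f.support, weight l s ≤ weight l a :=
  Finset.exists_max_image _ _ (Finset.nonempty_iff_ne_empty.mpr (by simpa using hf))

/-- No cancellation occurs at the top: weights are additive, injective and totally ordered, so `a +
b` splits in only one way into exponents of `f` and `g`. -/
theorem coeff_mul_of_weight_le (l : (Fin n → ℝ) →ₗ[ℝ] ℝ) {f g : MvPolynomial (Fin n) ℂ}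
    {a b : Fin n →₀ ℕ} (hf : ∀ s ∈ f.support, weight l s ≤ weight l a)
    (hg : ∀ s ∈ g.support, weight l s ≤ weight l b) :
    coeff (a + b) (f * g) = coeff a f * coeff b g := by
  classical
  rw [coeff_mul, Finset.sum_eq_single (a, b)]
  · rintro ⟨s, t⟩ hst hne
    rw [Finset.HasAntidiagonal.mem_antidiagonal] at hst
    simp only at hst ⊢
    by_contra h0
    have hs := hf s (by simpa using left_ne_zero_of_mul h0)
    have ht := hg t (by simpa using right_ne_zero_of_mul h0)
    have hsum : weight l s + weight l t = weight l a + weight l b := by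
      rw [← weight_add, ← weight_add, hst]
    have h1 := (add_eq_add_iff_eq_and_eq hs ht).mp hsum
    exact hne (Prod.ext (weight_injective l h1.1) (weight_injective l h1.2))
  · intro h
    simp at h

/-! ### The exponents of the Laurent polynomials `A_i / X_i` -/

theorem toLaurent_monomial (m : Fin n →₀ ℕ) (c : ℂ) :
    toLaurent n (monomial m c) = AddMonoidAlgebra.single (intVec m) c := by
  have key : (m.prod fun i k =>
      (AddMonoidAlgebra.single (Pi.single i (1 : ℤ)) (1 : ℂ) : Laurent n) ^ k) =
      AddMonoidAlgebra.single (intVec m) 1 := by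
    induction m using Finsupp.induction_linear with
    | zero =>
      simp only [Finsupp.prod_zero_index]
      rfl
    | add s t hs ht =>
      rw [Finsupp.prod_add_index' (by simp) (by intros; rw [pow_add]), hs, ht,
        AddMonoidAlgebra.single_mul_single, intVec_add, one_mul]
    | single i k =>
      rw [Finsupp.prod_single_index (by simp), AddMonoidAlgebra.single_pow, one_pow]
      congr 1
      ext j
      by_cases h : j = i
      · subst h; simp [intVec]
      · simp [intVec, h]
  rw [toLaurent, aeval_monomial, key]
  rw [AddMonoidAlgebra.coe_algebraMap]
  simp [AddMonoidAlgebra.single_mul_single]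

theorem coeff_toLaurent (f : MvPolynomial (Fin n) ℂ) (m : Fin n →₀ ℕ) :
    (toLaurent n f).coeff (intVec m) = coeff m f := by
  induction f using MvPolynomial.monomial_add_induction_on with
  | C a =>
    rw [C_apply, toLaurent_monomial, AddMonoidAlgebra.coeff_single, coeff_monomial]
    simp [Finsupp.single_apply, intVec_injective.eq_iff]
  | monomial_add s c f _ _ ih =>
    rw [map_add, AddMonoidAlgebra.coeff_add, Finsupp.add_apply, ih, toLaurent_monomial,
      AddMonoidAlgebra.coeff_single, coeff_add, coeff_monomial]
    simp [Finsupp.single_apply, intVec_injective.eq_iff]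

theorem coeff_toLaurent_mul_invX (f : MvPolynomial (Fin n) ℂ) (i : Fin n) (m : Fin n →₀ ℕ) :
    (toLaurent n f * invX i).coeff (intVec m + Pi.single i (-1)) = coeff m f := by
  rw [invX, AddMonoidAlgebra.coeff_mul_single_add, mul_one, coeff_toLaurent]

/-- The set of exponents of the Laurent polynomials `A_i / X_i`. -/
noncomputable def latticeSupport (A : Fin n → MvPolynomial (Fin n) ℂ) : Finset (Fin n → ℤ) :=
  Finset.univ.biUnion fun i => (toLaurent n (A i) * invX i).coeff.support

theorem mem_latticeSupport (A : Fin n → MvPolynomial (Fin n) ℂ) (s : Fin n → ℤ) :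
    s ∈ latticeSupport A ↔ ∃ i, (toLaurent n (A i) * invX i).coeff s ≠ 0 := by
  simp [latticeSupport]

/-- Each coefficient of `laurentSum A x` at an exponent of some `A_i / X_i` is a nonzero linear form
in `x`. Off the zero set of the product of these forms, no exponent is lost. -/
theorem isGenericNewtonPolytope_latticeSupport (A : Fin n → MvPolynomial (Fin n) ℂ) :
    IsGenericNewtonPolytope A (convexHull ℝ (realVec '' (latticeSupport A : Set (Fin n → ℤ)))) := by
  classical
  have hcoeff : ∀ (x : Fin n → ℂ) (s : Fin n → ℤ), (laurentSum A x).coeff s =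
      ∑ i, x i * (toLaurent n (A i) * invX i).coeff s := by
    intro x s
    rw [laurentSum, AddMonoidAlgebra.coeff_sum, Finsupp.finsetSum_apply]
    rfl
  refine ⟨∏ s ∈ latticeSupport A, ∑ i, C ((toLaurent n (A i) * invX i).coeff s) * X i, ?_, ?_⟩
  · rw [Finset.prod_ne_zero_iff]
    intro s hs h
    obtain ⟨i, hi⟩ := (mem_latticeSupport A s).mp hs
    apply hi
    have h1 := congrArg (eval (Pi.single i (1 : ℂ))) h
    simpa [Pi.single_apply] using h1
  · intro x hx
    rw [newtonPolytope]
    congr 2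
    ext s
    simp only [Set.mem_ofPred_eq, Finset.mem_coe]
    rw [hcoeff]
    constructor
    · intro h
      rw [mem_latticeSupport]
      by_contra! hc
      exact h (Finset.sum_eq_zero fun i _ => by rw [hc i, mul_zero])
    · intro hs h
      apply hx
      rw [map_prod]
      apply Finset.prod_eq_zero hs
      rw [← h]
      simp [mul_comm]

/-- In `(A_i / X_i) · X_i ∂_i f` the factor `X_i ∂_i` only rescales the terms of `f`, and `A_i /
X_i` then shifts them. -/
theorem exists_of_coeff_polyDerivation_ne_zero (A : Fin n → MvPolynomial (Fin n) ℂ)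
    (f : MvPolynomial (Fin n) ℂ) (e : Fin n →₀ ℕ) (he : coeff e (polyDerivation A f) ≠ 0) :
    ∃ m ∈ f.support, ∃ s ∈ latticeSupport A, intVec e = intVec m + s := by
  classical
  rw [polyDerivation_apply, coeff_sum] at he
  obtain ⟨i, -, hi⟩ := Finset.exists_ne_zero_of_sum_ne_zero he
  rw [coeff_mul] at hi
  obtain ⟨⟨x, y⟩, hxy, hne⟩ := Finset.exists_ne_zero_of_sum_ne_zero hi
  rw [Finset.HasAntidiagonal.mem_antidiagonal] at hxy
  simp only at hxy hne
  rw [coeff_pderiv] at hne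
  refine ⟨y + Finsupp.single i 1, ?_, intVec x + Pi.single i (-1), ?_, ?_⟩
  · rw [mem_support_iff]
    exact left_ne_zero_of_mul (right_ne_zero_of_mul hne)
  · rw [mem_latticeSupport]
    exact ⟨i, by rw [coeff_toLaurent_mul_invX]; exact left_ne_zero_of_mul hne⟩
  · rw [← hxy, intVec_add, intVec_add]
    ext j
    by_cases h : j = i
    · subst h; simp [intVec]; ring
    · simp [intVec, h, add_comm]

/-- The Newton polytope of a cofactor lies in that of the derivation. -/
theorem cofactor_support (A : Fin n → MvPolynomial (Fin n) ℂ) {f g : MvPolynomial (Fin n) ℂ}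
    (hf : f ≠ 0) (h : polyDerivation A f = g * f) {q : Fin n →₀ ℕ} (hq : q ∈ g.support) :
    realVec (intVec q) ∈ convexHull ℝ (realVec '' (latticeSupport A : Set (Fin n → ℤ))) := by
  by_contra hc
  -- Separate `q` from the hull by `l`. At the leading exponents `a` of `f` and `b` of `g`, `l b + l
  -- a = l m + l s ≤ l a + l s`, so `l b ≤ l s < u < l q ≤ l b`, a contradiction.
  obtain ⟨l, u, hl, hu⟩ := geometric_hahn_banach_closed_point (convex_convexHull ℝ _)
    (((latticeSupport A).finite_toSet.image realVec).isCompact_convexHull ℝ).isClosed hc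
  have hg : g ≠ 0 := by rintro rfl; simp at hq
  obtain ⟨a, ha, hamax⟩ := exists_leading l.toLinearMap hf
  obtain ⟨b, hb, hbmax⟩ := exists_leading l.toLinearMap hg
  have hne : coeff (b + a) (polyDerivation A f) ≠ 0 := by
    rw [h, coeff_mul_of_weight_le l.toLinearMap hbmax hamax]
    exact mul_ne_zero (by simpa using hb) (by simpa using ha)
  obtain ⟨m, hm, s, hs, e⟩ := exists_of_coeff_polyDerivation_ne_zero A f _ hne
  have h1 := apply_le_of_weight_le (hamax m hm)
  have h2 := apply_le_of_weight_le (hbmax q hq)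
  have h3 := hl _ (subset_convexHull ℝ _ ⟨s, hs, rfl⟩)
  have h4 := congrArg (fun v => l (realVec v)) e
  simp only [intVec_add, realVec_add, map_add] at h4
  simp only [ContinuousLinearMap.coe_coe] at h1 h2
  linarith
/-! ### Logarithmic differentials -/

theorem totalDegree_pderiv_lt {f : MvPolynomial (Fin n) ℂ} {j : Fin n} (h : pderiv j f ≠ 0) :
    (pderiv j f).totalDegree < f.totalDegree := by
  obtain ⟨y, hy, hmax⟩ := Finset.exists_mem_eq_sup (pderiv j f).support
    (Finset.nonempty_iff_ne_empty.mpr (by simpa using h)) (fun s => s.sum fun _ e => e)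
  rw [totalDegree, hmax]
  rw [mem_support_iff, coeff_pderiv] at hy
  have h1 := le_totalDegree (mem_support_iff.mpr (left_ne_zero_of_mul hy))
  rw [Finsupp.sum_add_index' (by simp) (by simp), Finsupp.sum_single_index rfl] at h1
  omega

theorem pderiv_eq_zero_of_dvd {f : MvPolynomial (Fin n) ℂ} {j : Fin n} (h : f ∣ pderiv j f) :
    pderiv j f = 0 := by
  by_contra h0
  obtain ⟨g, hg⟩ := h
  have h1 := totalDegree_pderiv_lt h0
  rw [hg] at h0
  rw [hg, totalDegree_mul_of_isDomain (left_ne_zero_of_mul h0) (right_ne_zero_of_mul h0)] at h1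
  omega

theorem eq_C_of_forall_pderiv_eq_zero {f : MvPolynomial (Fin n) ℂ} (h : ∀ j, pderiv j f = 0) :
    f = C (coeff 0 f) := by
  ext s
  rw [coeff_C]
  split_ifs with hs
  · rw [hs]
  · obtain ⟨j, hj⟩ : ∃ j, s j ≠ 0 := by
      by_contra! hc
      exact hs (Finsupp.ext fun j => (hc j).symm)
    have h1 := coeff_pderiv f (i := j) (s - Finsupp.single j 1)
    rw [h j, coeff_zero, tsub_add_cancel_of_le
      (Finsupp.single_le_iff.mpr (Nat.one_le_iff_ne_zero.mpr hj))] at h1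
    exact (mul_eq_zero.mp h1.symm).resolve_right (Nat.cast_add_one_ne_zero _)

/-- The coefficients of the differential form `∑ λ_i df_i / f_i`, multiplied by `∏ f_i`. -/
noncomputable def logForm (f : Fin m → MvPolynomial (Fin n) ℂ) :
    (Fin m → ℂ) →ₗ[ℂ] (Fin n → MvPolynomial (Fin n) ℂ) where
  toFun lam j := ∑ i, lam i • (pderiv j (f i) * ∏ k ∈ Finset.univ.erase i, f k)
  map_add' a b := by
    ext1 j
    simp [add_smul, Finset.sum_add_distrib]
  map_smul' c a := by
    ext1 j
    simp [mul_smul, Finset.smul_sum]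

theorem logForm_apply (f : Fin m → MvPolynomial (Fin n) ℂ) (lam : Fin m → ℂ) (j : Fin n) :
    logForm f lam j = ∑ i, lam i • (pderiv j (f i) * ∏ k ∈ Finset.univ.erase i, f k) := rfl

/-- Modulo `f i` only the `i`-th summand survives. If `lam i ≠ 0`, coprimality gives `f i ∣ pderiv j
(f i)`; since the degree drops, this derivative is zero for every `j`, and `f i` is constant. -/
theorem logForm_injective {D : Derivation ℂ (MvPolynomial (Fin n) ℂ) (MvPolynomial (Fin n) ℂ)}
    {f : Fin m → MvPolynomial (Fin n) ℂ} (hf : IsDarbouxFamily D f) :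
    Function.Injective (logForm f) := by
  rw [injective_iff_map_eq_zero]
  intro lam h
  ext1 i
  by_contra hi
  refine hf.nonconstant i (coeff 0 (f i)) (eq_C_of_forall_pderiv_eq_zero fun j => ?_)
  apply pderiv_eq_zero_of_dvd
  have h1 := congrFun h j
  rw [logForm_apply, ← Finset.add_sum_erase _ _ (Finset.mem_univ i)] at h1
  have h2 : f i ∣ lam i • (pderiv j (f i) * ∏ k ∈ Finset.univ.erase i, f k) := by
    rw [eq_neg_of_add_eq_zero_left h1, dvd_neg]
    refine Finset.dvd_sum fun k hk => ?_
    apply dvd_smul_of_dvd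
    apply Dvd.dvd.mul_left
    exact Finset.dvd_prod_of_mem _ (Finset.mem_erase.mpr
      ⟨(Finset.ne_of_mem_erase hk).symm, Finset.mem_univ i⟩)
  have h3 : f i ∣ pderiv j (f i) * ∏ k ∈ Finset.univ.erase i, f k := by
    have := dvd_smul_of_dvd (lam i)⁻¹ h2
    rwa [smul_smul, inv_mul_cancel₀ hi, one_smul] at this
  refine (IsRelPrime.prod_right fun k hk => ?_ : IsRelPrime (f i) _).dvd_of_dvd_mul_right h3
  exact hf.coprime i k (Finset.ne_of_mem_erase hk).symm

theorem IsDarbouxFamily.ne_zero {D : Derivation ℂ (MvPolynomial (Fin n) ℂ) (MvPolynomial (Fin n) ℂ)}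
    {f : Fin m → MvPolynomial (Fin n) ℂ} (hf : IsDarbouxFamily D f) (i : Fin m) : f i ≠ 0 := by
  have := hf.nonconstant i 0
  rwa [C_0] at this

/-! ### Darboux first integrals -/

theorem exists_hasFDerivAt_eval (f : MvPolynomial (Fin n) ℂ) (x : Fin n → ℂ) :
    ∃ f' : (Fin n → ℂ) →L[ℂ] ℂ, HasFDerivAt (𝕜 := ℂ) (fun y => eval y f) f' x ∧
      ∀ v, f' v = ∑ j, eval x (pderiv j f) * v j := by
  induction f using MvPolynomial.induction_on with
  | C a =>
    refine ⟨0, ?_, by simp⟩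
    simp only [eval_C]
    exact hasFDerivAt_const (𝕜 := ℂ) a x
  | add p q hp hq =>
    obtain ⟨p', hp, hp'⟩ := hp
    obtain ⟨q', hq, hq'⟩ := hq
    refine ⟨p' + q', ?_, fun v => ?_⟩
    · simp only [map_add]
      exact hp.fun_add hq
    · simp [hp', hq', add_mul, Finset.sum_add_distrib]
  | mul_X p i hp =>
    obtain ⟨p', hp, hp'⟩ := hp
    have hX : HasFDerivAt (fun y : Fin n → ℂ => y i)
      (ContinuousLinearMap.proj i : (Fin n → ℂ) →L[ℂ] ℂ) x := hasFDerivAt_apply i x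
    refine ⟨_, by simpa only [map_mul, eval_X] using hp.fun_mul hX, fun v => ?_⟩
    simp [Derivation.leibniz, pderiv_X, Pi.single_apply, hp', add_mul, Finset.sum_add_distrib,
      Finset.mul_sum, apply_ite (eval x), mul_assoc]

theorem differentiable_eval (f : MvPolynomial (Fin n) ℂ) :
    Differentiable ℂ fun y : Fin n → ℂ => eval y f := fun x =>
  let ⟨_, h, _⟩ := exists_hasFDerivAt_eval f x
  h.differentiableAt

theorem fderiv_eval_single (f : MvPolynomial (Fin n) ℂ) (x : Fin n → ℂ) (j : Fin n) :
    fderiv ℂ (fun y => eval y f) x (Pi.single j 1) = eval x (pderiv j f) := by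
  obtain ⟨f', h, h'⟩ := exists_hasFDerivAt_eval f x
  rw [h.fderiv, h']
  simp [Pi.single_apply]

namespace IsLogBranch

variable {f : Fin m → MvPolynomial (Fin n) ℂ} {U : Set (Fin n → ℂ)}
  {L : Fin m → (Fin n → ℂ) → ℂ}

theorem differentiableAt (h : IsLogBranch f U L) {x : Fin n → ℂ} (hx : x ∈ U) (i : Fin m) :
    DifferentiableAt ℂ (L i) x :=
  (h.holomorphic i).differentiableAt (h.isOpen.mem_nhds hx)

/-- This is `∂_j L_i = ∂_j f_i / f_i` without division, from differentiating `exp L_i = f_i`. -/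
theorem eval_mul_fderiv (h : IsLogBranch f U L) {x : Fin n → ℂ} (hx : x ∈ U) (i : Fin m)
    (j : Fin n) :
    eval x (f i) * fderiv ℂ (L i) x (Pi.single j 1) = eval x (pderiv j (f i)) := by
  rw [← fderiv_eval_single]
  have e : (fun y => eval y (f i)) =ᶠ[nhds x] fun y => Complex.exp (L i y) := by
    filter_upwards [h.isOpen.mem_nhds hx] with y hy
    exact (h.exp_eq i y hy).symm
  rw [e.fderiv_eq, ((h.differentiableAt hx i).hasFDerivAt.cexp).fderiv, ← h.exp_eq i x hx]
  simp

theorem fderiv_cpowProd (h : IsLogBranch f U L) {x : Fin n → ℂ} (hx : x ∈ U) (lam : Fin m → ℂ)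
    (v : Fin n → ℂ) :
    fderiv ℂ (cpowProd lam L) x v = cpowProd lam L x * ∑ i, lam i * fderiv ℂ (L i) x v := by
  have h1 : HasFDerivAt (fun y => ∑ i, lam i * L i y) (∑ i, lam i • fderiv ℂ (L i) x) x :=
    HasFDerivAt.fun_sum fun i _ => (h.differentiableAt hx i).hasFDerivAt.const_mul (lam i)
  have h2 : HasFDerivAt (cpowProd lam L) _ x := h1.cexp
  rw [h2.fderiv]
  simp [cpowProd]

theorem eval_logForm (h : IsLogBranch f U L) {x : Fin n → ℂ} (hx : x ∈ U) (lam : Fin m → ℂ)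
    (j : Fin n) :
    eval x (logForm f lam j) =
      (∏ i, eval x (f i)) * ∑ i, lam i * fderiv ℂ (L i) x (Pi.single j 1) := by
  rw [logForm_apply, map_sum, Finset.mul_sum]
  refine Finset.sum_congr rfl fun i _ => ?_
  rw [smul_eval, map_mul, ← h.eval_mul_fderiv hx, map_prod,
    ← Finset.mul_prod_erase _ _ (Finset.mem_univ i)]
  ring

end IsLogBranch

theorem exists_isLogBranch {f : Fin m → MvPolynomial (Fin n) ℂ} (hf : ∀ i, f i ≠ 0) :
    ∃ U L, IsLogBranch f U L := by
  have hP : ∏ i, f i ≠ 0 := Finset.prod_ne_zero_iff.mpr fun i _ => hf i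
  obtain ⟨a, ha⟩ : ∃ a, eval a (∏ i, f i) ≠ 0 := by
    by_contra! hc
    exact hP (MvPolynomial.funext fun x => by rw [hc x, map_zero])
  rw [map_prod, Finset.prod_ne_zero_iff] at ha
  have ha' : ∀ i, eval a (f i) ≠ 0 := fun i => ha i (Finset.mem_univ i)
  -- Dividing by the value at `a` makes every quotient equal to `1` there, inside the slit plane;
  -- the constant `log (f_i(a))` restores the normalisation.
  refine ⟨⋂ i, (fun x => eval x (f i) / eval a (f i)) ⁻¹' Complex.slitPlane,
    fun i x => Complex.log (eval x (f i) / eval a (f i)) + Complex.log (eval a (f i)),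
    ?_, ⟨a, ?_⟩, ?_, ?_⟩
  · exact isOpen_iInter_of_finite fun i =>
      Complex.isOpen_slitPlane.preimage ((differentiable_eval (f i)).continuous.div_const _)
  · simp [ha']
  · intro i x hx
    have hx := Set.mem_iInter.mp hx i
    have h1 : DifferentiableAt ℂ (fun y => eval y (f i) / eval a (f i)) x := by
      simp only [div_eq_mul_inv]
      exact (differentiable_eval (f i) x).mul_const _
    exact ((h1.clog hx).add_const _).differentiableWithinAt
  · intro i x hx
    have hx := Complex.slitPlane_ne_zero (Set.mem_iInter.mp hx i)
    rw [Complex.exp_add, Complex.exp_log hx, Complex.exp_log (ha' i), div_mul_cancel₀ _ (ha' i)]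

theorem eq_zero_of_eval_eq_zero_on_open {p : MvPolynomial (Fin n) ℂ} {U : Set (Fin n → ℂ)}
    (hU : IsOpen U) (hne : U.Nonempty) (h : ∀ x ∈ U, eval x p = 0) : p = 0 := by
  obtain ⟨a, ha⟩ := hne
  obtain ⟨r, hr, hball⟩ := Metric.isOpen_iff.mp hU a ha
  refine MvPolynomial.funext_set (fun i => Metric.ball (a i) r)
    (fun i => ?_) fun x hx => ?_
  · exact infinite_of_mem_nhds (a i) (Metric.ball_mem_nhds _ hr)
  · rw [map_zero]
    apply h
    apply hball
    rw [Metric.mem_ball, dist_pi_lt_iff hr]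
    exact fun i => hx i (Set.mem_univ i)

theorem isDarbouxFirstIntegral_of_relation {A : Fin n → MvPolynomial (Fin n) ℂ}
    {f g : Fin m → MvPolynomial (Fin n) ℂ} (hf : IsDarbouxFamily (polyDerivation A) f)
    (hg : ∀ i, polyDerivation A (f i) = g i * f i) {lam : Fin m → ℂ} (hlam : lam ≠ 0)
    (hrel : ∑ i, lam i • g i = 0) : IsDarbouxFirstIntegral A f lam := by
  refine ⟨exists_isLogBranch hf.ne_zero, fun U L h => ⟨?_, fun x hx => ?_⟩⟩
  · rintro ⟨c, hc⟩
    -- A constant branch has zero logarithmic differential, so `logForm f lam` vanishes on an open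
    -- set and therefore identically.
    apply hlam
    apply logForm_injective hf
    rw [map_zero]
    ext1 j
    refine eq_zero_of_eval_eq_zero_on_open h.isOpen h.nonempty fun x hx => ?_
    have e : cpowProd lam L =ᶠ[nhds x] fun _ => c := by
      filter_upwards [h.isOpen.mem_nhds hx] with y hy
      exact hc y hy
    have h1 := h.fderiv_cpowProd hx lam (Pi.single j 1)
    rw [e.fderiv_eq] at h1
    have h2 : cpowProd lam L x ≠ 0 := Complex.exp_ne_zero _
    have h3 : ∑ i, lam i * fderiv ℂ (L i) x (Pi.single j 1) = 0 := by
      simpa [h2] using h1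
    rw [h.eval_logForm hx, h3, mul_zero]
  · have h1 : ∀ i, ∑ j, eval x (A j) * fderiv ℂ (L i) x (Pi.single j 1) = eval x (g i) := by
      intro i
      have hne : eval x (f i) ≠ 0 := by rw [← h.exp_eq i x hx]; exact Complex.exp_ne_zero _
      have h2 := congrArg (eval x) (hg i)
      rw [polyDerivation_apply, map_sum, map_mul] at h2
      apply mul_right_cancel₀ hne
      rw [← h2, Finset.sum_mul]
      refine Finset.sum_congr rfl fun j _ => ?_
      rw [map_mul, ← h.eval_mul_fderiv hx]
      ring
    have h3 := congrArg (eval x) hrel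
    rw [map_sum, map_zero] at h3
    calc ∑ j, eval x (A j) * fderiv ℂ (cpowProd lam L) x (Pi.single j 1)
        = cpowProd lam L x *
          ∑ i, lam i * ∑ j, eval x (A j) * fderiv ℂ (L i) x (Pi.single j 1) := by
          simp only [h.fderiv_cpowProd hx, Finset.mul_sum]
          rw [Finset.sum_comm]
          refine Finset.sum_congr rfl fun i _ => Finset.sum_congr rfl fun j _ => by ring
      _ = 0 := by
          simp only [h1]
          simp only [smul_eval] at h3
          rw [h3, mul_zero]
/-! ### Relations between cofactors -/

/-- The exponents of the monomials allowed in a cofactor. -/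
def cofactorExponents (N : Set (Fin n → ℝ)) : Set (Fin n →₀ ℕ) := {q | realVec (intVec q) ∈ N}

theorem realVec_intVec (q : Fin n →₀ ℕ) : realVec (intVec q) = fun i => (q i : ℝ) := by
  ext i
  simp [realVec, intVec]

theorem ncard_cofactorExponents (N : Set (Fin n → ℝ)) :
    (cofactorExponents N).ncard = natPointCount N := by
  refine Set.ncard_congr (fun q _ => ⇑q) (fun q hq => ?_)
    (fun a b _ _ h => DFunLike.coe_injective h)
    fun b hb => ⟨Finsupp.equivFunOnFinite.symm b, ?_, rfl⟩
  · rw [cofactorExponents, Set.mem_ofPred_eq, realVec_intVec] at hq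
    exact hq
  · rw [cofactorExponents, Set.mem_ofPred_eq, realVec_intVec]
    exact hb

/-- The hull is compact, so its natural points have bounded coordinates. Finiteness matters because
`natPointCount` is an `ncard`, which is `0` on infinite sets. -/
theorem finite_cofactorExponents (S : Finset (Fin n → ℤ)) :
    (cofactorExponents (convexHull ℝ (realVec '' (S : Set (Fin n → ℤ))))).Finite := by
  obtain ⟨R, hR⟩ :=
    ((S.finite_toSet.image realVec).isCompact_convexHull ℝ).isBounded.exists_norm_le
  refine (Set.finite_Iic (Finsupp.equivFunOnFinite.symm fun _ : Fin n => ⌈R⌉₊)).subset ?_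
  intro q hq i
  have h1 : |(q i : ℝ)| ≤ R := (norm_le_pi_norm (realVec (intVec q)) i).trans (hR _ hq)
  rw [Nat.abs_cast] at h1
  exact_mod_cast h1.trans (Nat.le_ceil R)

/-- The linear map sending `λ` to `∑ λ_i g_i`. -/
noncomputable def relationMap (g : Fin m → MvPolynomial (Fin n) ℂ) :
    (Fin m → ℂ) →ₗ[ℂ] MvPolynomial (Fin n) ℂ :=
  Fintype.linearCombination ℂ g

theorem relationMap_apply (g : Fin m → MvPolynomial (Fin n) ℂ) (lam : Fin m → ℂ) :
    relationMap g lam = ∑ i, lam i • g i := rfl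

/-- Rank-nullity: the range lies in the span of the allowed monomials, of dimension `natPointCount
N`. -/
theorem le_finrank_ker_relationMap {N : Set (Fin n → ℝ)} (hN : (cofactorExponents N).Finite)
    {g : Fin m → MvPolynomial (Fin n) ℂ}
    (hg : ∀ i, ∀ q ∈ (g i).support, q ∈ cofactorExponents N) {r : ℕ}
    (hr : natPointCount N + r ≤ m) : r ≤ Module.finrank ℂ (LinearMap.ker (relationMap g)) := by
  have h1 := LinearMap.finrank_range_add_finrank_ker (relationMap g)
  rw [Module.finrank_fin_fun] at h1
  have := hN.to_subtype
  have : Module.Finite ℂ (restrictSupport ℂ (cofactorExponents N)) :=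
    Module.Finite.of_basis (basisRestrictSupport ℂ (cofactorExponents N))
  have h2 : LinearMap.range (relationMap g) ≤ restrictSupport ℂ (cofactorExponents N) := by
    rintro _ ⟨lam, rfl⟩
    rw [relationMap_apply]
    refine Submodule.sum_mem _ fun i _ => Submodule.smul_mem _ _ ?_
    exact (mem_restrictSupport_iff ℂ).mpr fun q hq => hg i q hq
  have h3 := Submodule.finrank_mono h2
  rw [Module.finrank_eq_nat_card_basis (basisRestrictSupport ℂ (cofactorExponents N)),
    Nat.card_coe_set_eq, ncard_cofactorExponents] at h3
  omega

/-! ### The evolution of logarithmic differentials along the derivation -/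

theorem pderiv_comm (i j : Fin n) (f : MvPolynomial (Fin n) ℂ) :
    pderiv i (pderiv j f) = pderiv j (pderiv i f) := by
  have h : ⁅(pderiv i : Derivation ℂ (MvPolynomial (Fin n) ℂ) (MvPolynomial (Fin n) ℂ)),
      (pderiv j : Derivation ℂ (MvPolynomial (Fin n) ℂ) (MvPolynomial (Fin n) ℂ))⁆ = 0 := by
    refine derivation_ext fun k => ?_
    rw [Derivation.commutator_apply (R := ℂ)]
    simp [pderiv_X, Pi.single_apply, apply_ite]
  have h1 := DFunLike.congr_fun h f
  rw [Derivation.commutator_apply] at h1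
  exact sub_eq_zero.mp h1

theorem polyDerivation_pderiv (A : Fin n → MvPolynomial (Fin n) ℂ) (j : Fin n)
    (f : MvPolynomial (Fin n) ℂ) :
    polyDerivation A (pderiv j f) =
      pderiv j (polyDerivation A f) - ∑ k, pderiv j (A k) * pderiv k f := by
  simp only [polyDerivation_apply, map_sum]
  rw [← Finset.sum_sub_distrib]
  refine Finset.sum_congr rfl fun k _ => ?_
  rw [Derivation.leibniz, pderiv_comm k j]
  simp only [smul_eq_mul]
  ring

theorem derivation_prod_of_cofactor
    (D : Derivation ℂ (MvPolynomial (Fin n) ℂ) (MvPolynomial (Fin n) ℂ))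
    {f g : Fin m → MvPolynomial (Fin n) ℂ} (hg : ∀ i, D (f i) = g i * f i) (s : Finset (Fin m)) :
    D (∏ i ∈ s, f i) = (∑ i ∈ s, g i) * ∏ i ∈ s, f i := by
  induction s using Finset.induction_on with
  | empty => simp
  | insert i s hi ih =>
    rw [Finset.prod_insert hi, Finset.sum_insert hi, Derivation.leibniz, ih, hg]
    simp only [smul_eq_mul]
    ring

/-- For `ω = ∑ λ_i df_i / f_i` the Lie derivative along `D` is `d(∑ λ_i g_i) = 0`, that is `D ω_j =
-∑ ∂_j A_k ω_k`. Clearing denominators by `∏ f_i`, which has cofactor `∑ g_i`, adds the first term.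
The resulting system does not depend on `lam`. -/
theorem polyDerivation_logForm {A : Fin n → MvPolynomial (Fin n) ℂ}
    {f g : Fin m → MvPolynomial (Fin n) ℂ} (hg : ∀ i, polyDerivation A (f i) = g i * f i)
    {lam : Fin m → ℂ} (hrel : ∑ i, lam i • g i = 0) (j : Fin n) :
    polyDerivation A (logForm f lam j) =
      (∑ i, g i) * logForm f lam j - ∑ k, pderiv j (A k) * logForm f lam k := by
  have hterm : ∀ i, polyDerivation A (pderiv j (f i) * ∏ k ∈ Finset.univ.erase i, f k) =
      (∑ i, g i) * (pderiv j (f i) * ∏ k ∈ Finset.univ.erase i, f k) +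
      (∏ i, f i) * pderiv j (g i) -
      ∑ k, pderiv j (A k) * (pderiv k (f i) * ∏ k ∈ Finset.univ.erase i, f k) := by
    intro i
    rw [Derivation.leibniz, derivation_prod_of_cofactor _ hg, polyDerivation_pderiv, hg,
      Derivation.leibniz, ← Finset.add_sum_erase _ g (Finset.mem_univ i),
      ← Finset.mul_prod_erase _ f (Finset.mem_univ i)]
    simp only [smul_eq_mul, ← mul_assoc, ← Finset.sum_mul]
    ring
  have hrel' : ∑ i, lam i • pderiv j (g i) = 0 := by
    have := congrArg (pderiv j) hrel
    simpa using this
  calc polyDerivation A (logForm f lam j)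
      = ∑ i, lam i • polyDerivation A (pderiv j (f i) * ∏ k ∈ Finset.univ.erase i, f k) := by
        rw [logForm_apply, map_sum]
        simp only [Derivation.map_smul]
    _ = (∑ i, g i) * logForm f lam j + (∏ i, f i) * ∑ i, lam i • pderiv j (g i) -
        ∑ k, pderiv j (A k) * logForm f lam k := by
        simp only [hterm, logForm_apply, smul_sub, smul_add, Finset.sum_sub_distrib,
          Finset.sum_add_distrib, Finset.mul_sum, Finset.smul_sum, mul_smul_comm]
        congr 1
        rw [Finset.sum_comm]
    _ = _ := by rw [hrel', mul_zero, add_zero]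

theorem sum_mul_logForm {A : Fin n → MvPolynomial (Fin n) ℂ}
    {f g : Fin m → MvPolynomial (Fin n) ℂ} (hg : ∀ i, polyDerivation A (f i) = g i * f i)
    {lam : Fin m → ℂ} (hrel : ∑ i, lam i • g i = 0) :
    ∑ j, A j * logForm f lam j = 0 := by
  calc ∑ j, A j * logForm f lam j
      = ∑ i, lam i • (polyDerivation A (f i) * ∏ k ∈ Finset.univ.erase i, f k) := by
        simp only [logForm_apply, polyDerivation_apply, Finset.mul_sum, Finset.sum_mul,
          Finset.smul_sum, mul_smul_comm, mul_assoc]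
        rw [Finset.sum_comm]
    _ = (∑ i, lam i • g i) * ∏ i, f i := by
        rw [Finset.sum_mul]
        refine Finset.sum_congr rfl fun i _ => ?_
        rw [hg, mul_assoc, Finset.mul_prod_erase _ _ (Finset.mem_univ i), smul_mul_assoc]
    _ = 0 := by rw [hrel, zero_mul]

/-! ### Linear differential systems over a differential field -/

/-- Solutions of a linear differential system that are independent over the constants are
independent. -/
theorem linearIndependent_of_solutions {k K ι : Type*} [Field k] [Field K] [Algebra k K]
    [Fintype ι] (D : Derivation k K K) (hD : ∀ x, D x = 0 → ∃ c, algebraMap k K c = x)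
    (M : Matrix ι ι K) {r : ℕ} (v : Fin r → ι → K)
    (hv : ∀ a i, D (v a i) = M.mulVec (v a) i) (h : LinearIndependent k v) :
    LinearIndependent K v := by
  induction r with
  | zero => exact linearIndependent_empty_type
  | succ r ih =>
    rw [linearIndependent_finSucc] at h ⊢
    have ht := ih (Fin.tail v) (fun a i => hv a.succ i) h.1
    refine ⟨ht, fun hmem => h.2 ?_⟩
    rw [Submodule.mem_span_range_iff_exists_fun] at hmem ⊢
    obtain ⟨c, hc⟩ := hmem
    -- Applying `D` to `v 0 = ∑ c_a v_a`, the terms with `M` cancel and leave a relation with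
    -- coefficients `D (c a)`. These vanish by induction, so every `c a` is a constant and the
    -- dependence already holds over `k`.
    have hzero : ∑ a, D (c a) • Fin.tail v a = 0 := by
      ext1 i
      have h1 := congrArg D (congrFun hc i)
      have h2 : M.mulVec (v 0) i = ∑ a, c a * M.mulVec (Fin.tail v a) i := by
        rw [← hc, Matrix.mulVec_sum]
        simp [Matrix.mulVec_smul, Finset.sum_apply]
      rw [hv, h2, Finset.sum_apply, map_sum] at h1
      simp only [Pi.smul_apply, smul_eq_mul, Derivation.leibniz] at h1
      rw [Finset.sum_add_distrib] at h1
      have h3 : ∑ a, c a * D (Fin.tail v a i) = ∑ a, c a * M.mulVec (Fin.tail v a) i :=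
        Finset.sum_congr rfl fun a _ => congrArg _ (hv a.succ i)
      rw [h3, add_eq_left] at h1
      rw [Finset.sum_apply]
      exact (Finset.sum_congr rfl fun a _ => mul_comm _ _).trans h1
    choose c' hc' using fun a => hD (c a) (Fintype.linearIndependent_iff.mp ht _ hzero a)
    refine ⟨c', ?_⟩
    rw [← hc]
    refine Finset.sum_congr rfl fun a _ => ?_
    rw [← hc' a, algebraMap_smul]

/-! ### Rational first integrals -/

section Extend

variable (D : Derivation ℂ (MvPolynomial (Fin n) ℂ) (MvPolynomial (Fin n) ℂ))

theorem exists_eq_div (F : RatFun n) : ∃ P Q : MvPolynomial (Fin n) ℂ, Q ≠ 0 ∧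
    algebraMap _ (RatFun n) Q ≠ 0 ∧
    F = algebraMap _ (RatFun n) P / algebraMap _ (RatFun n) Q := by
  obtain ⟨P, Q, hQ, h⟩ := IsFractionRing.div_surjective (MvPolynomial (Fin n) ℂ) F
  have hQ := nonZeroDivisors.ne_zero hQ
  exact ⟨P, Q, hQ, by simpa using hQ, h.symm⟩

theorem extend_add (F G : RatFun n) : extend D (F + G) = extend D F + extend D G := by
  obtain ⟨P, Q, hQ, h1, rfl⟩ := exists_eq_div F
  obtain ⟨P', Q', hQ', h2, rfl⟩ := exists_eq_div G
  rw [div_add_div _ _ h1 h2, ← map_mul, ← map_mul, ← map_mul, ← map_add,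
    extend_div _ _ _ (mul_ne_zero hQ hQ'), extend_div _ _ _ hQ, extend_div _ _ _ hQ']
  simp only [Derivation.leibniz, map_add, map_sub, map_mul, smul_eq_mul]
  field_simp
  ring

theorem extend_mul (F G : RatFun n) :
    extend D (F * G) = F * extend D G + G * extend D F := by
  obtain ⟨P, Q, hQ, h1, rfl⟩ := exists_eq_div F
  obtain ⟨P', Q', hQ', h2, rfl⟩ := exists_eq_div G
  rw [div_mul_div_comm, ← map_mul, ← map_mul,
    extend_div _ _ _ (mul_ne_zero hQ hQ'), extend_div _ _ _ hQ, extend_div _ _ _ hQ']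
  simp only [Derivation.leibniz, map_add, map_sub, map_mul, smul_eq_mul]
  field_simp
  ring

theorem extend_algebraMap (P : MvPolynomial (Fin n) ℂ) :
    extend D (algebraMap _ (RatFun n) P) = algebraMap _ (RatFun n) (D P) := by
  have h := extend_div D P 1 one_ne_zero
  rwa [map_one, div_one, Derivation.map_one_eq_zero, mul_one, mul_zero, sub_zero, one_pow,
    div_one] at h

theorem extend_smul (c : ℂ) (F : RatFun n) : extend D (c • F) = c • extend D F := by
  rw [Algebra.smul_def, Algebra.smul_def,
    IsScalarTower.algebraMap_apply ℂ (MvPolynomial (Fin n) ℂ) (RatFun n), extend_mul,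
    extend_algebraMap, Derivation.map_algebraMap, map_zero, mul_zero, add_zero]

/-- The derivation of the field of rational functions that extends `D`. -/
noncomputable def extendDerivation : Derivation ℂ (RatFun n) (RatFun n) where
  toFun := extend D
  map_add' := extend_add D
  map_smul' := extend_smul D
  map_one_eq_zero' := by
    have h := extend_algebraMap D 1
    rw [map_one, Derivation.map_one_eq_zero, map_zero] at h
    exact h
  leibniz' := extend_mul D

theorem extendDerivation_algebraMap (P : MvPolynomial (Fin n) ℂ) :
    extendDerivation D (algebraMap _ (RatFun n) P) = algebraMap _ (RatFun n) (D P) :=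
  extend_algebraMap D P

end Extend

theorem exists_isRationalFirstIntegral {A : Fin n → MvPolynomial (Fin n) ℂ} (hA : A ≠ 0)
    {f g : Fin m → MvPolynomial (Fin n) ℂ} (hf : IsDarbouxFamily (polyDerivation A) f)
    (hg : ∀ i, polyDerivation A (f i) = g i * f i)
    (hr : n ≤ Module.finrank ℂ (LinearMap.ker (relationMap g))) :
    ∃ F, IsRationalFirstIntegral (polyDerivation A) F := by
  by_contra hno
  have hconst : ∀ x, extendDerivation (polyDerivation A) x = 0 →
      ∃ c, algebraMap ℂ (RatFun n) c = x := by
    intro x hx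
    by_contra! hc
    refine hno ⟨x, fun c h => hc c ?_, hx⟩
    rw [h, ← algebraMap_eq, ← IsScalarTower.algebraMap_apply]
  have inj : Function.Injective (algebraMap (MvPolynomial (Fin n) ℂ) (RatFun n)) :=
    IsFractionRing.injective _ _
  let b := Module.finBasis ℂ (LinearMap.ker (relationMap g))
  let v : Fin (Module.finrank ℂ (LinearMap.ker (relationMap g))) → Fin n → RatFun n :=
    fun a j => algebraMap _ (RatFun n) (logForm f (b a) j)
  have hrel : ∀ a, ∑ i, (b a : Fin m → ℂ) i • g i = 0 := fun a => (b a).2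
  have hind : LinearIndependent ℂ v := by
    let T : LinearMap.ker (relationMap g) →ₗ[ℂ] Fin n → RatFun n :=
      ((IsScalarTower.toAlgHom ℂ (MvPolynomial (Fin n) ℂ) (RatFun n)).toLinearMap.compLeft
        (Fin n)) ∘ₗ logForm f ∘ₗ (LinearMap.ker (relationMap g)).subtype
    refine b.linearIndependent.map' T (LinearMap.ker_eq_bot.mpr ?_)
    intro x y hxy
    apply Subtype.ext
    apply logForm_injective hf
    ext1 j
    exact inj (congrFun hxy j)
  let M : Matrix (Fin n) (Fin n) (RatFun n) := fun j k =>
    (if j = k then algebraMap _ (RatFun n) (∑ i, g i) else 0) -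
      algebraMap _ (RatFun n) (pderiv j (A k))
  have hK : LinearIndependent (RatFun n) v := by
    refine linearIndependent_of_solutions (extendDerivation (polyDerivation A)) hconst M v ?_ hind
    intro a j
    rw [extendDerivation_algebraMap, polyDerivation_logForm hg (hrel a)]
    simp only [Matrix.mulVec, dotProduct, M, v, sub_mul, Finset.sum_sub_distrib, ite_mul, zero_mul,
      Finset.sum_ite_eq, Finset.mem_univ, if_true, map_sub, map_mul, map_sum]
  -- Contraction of a 1-form with the vector field: it is nonzero since `A ≠ 0`, so its kernel has
  -- dimension less than `n`, yet it contains all the `v a`.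
  let φ : (Fin n → RatFun n) →ₗ[RatFun n] RatFun n :=
    Fintype.linearCombination (RatFun n) fun j => algebraMap _ (RatFun n) (A j)
  have hφ : LinearMap.ker φ ≠ ⊤ := by
    intro h
    apply hA
    ext1 j
    have h1 : φ (Pi.single j 1) = 0 := by
      rw [← LinearMap.mem_ker, h]; trivial
    apply inj
    simpa [φ, Fintype.linearCombination_apply, Pi.single_apply] using h1
  have hle : Submodule.span (RatFun n) (Set.range v) ≤ LinearMap.ker φ := by
    rw [Submodule.span_le]
    rintro _ ⟨a, rfl⟩
    have h1 := congrArg (algebraMap _ (RatFun n)) (sum_mul_logForm hg (hrel a))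
    simpa [φ, Fintype.linearCombination_apply, v, mul_comm] using h1
  have h1 := Submodule.finrank_lt hφ
  have h2 := Submodule.finrank_mono hle
  rw [finrank_span_eq_card hK, Fintype.card_fin] at h2
  rw [Module.finrank_fin_fun] at h1
  omega

/-- The hyperplane argument needs `A ≠ 0`; for `A = 0` any nonconstant polynomial is a first
integral. -/
theorem exists_isRationalFirstIntegral_of_eq_zero {A : Fin n → MvPolynomial (Fin n) ℂ} (hA : A = 0)
    {f : Fin m → MvPolynomial (Fin n) ℂ} (hf : IsDarbouxFamily (polyDerivation A) f) (hm : 0 < m) :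
    ∃ F, IsRationalFirstIntegral (polyDerivation A) F := by
  refine ⟨algebraMap _ (RatFun n) (f ⟨0, hm⟩), fun c h => ?_, ?_⟩
  · exact hf.nonconstant _ c (IsFractionRing.injective _ (RatFun n) h)
  · rw [extend_algebraMap, polyDerivation_apply]
    simp [hA]

/-! ### Derivations with a nonresonant diagonal part -/

theorem weight_le_of_mem_support_mul (l : (Fin n → ℝ) →ₗ[ℝ] ℝ) {f g : MvPolynomial (Fin n) ℂ}
    {a b : Fin n →₀ ℕ} (hf : ∀ s ∈ f.support, weight l s ≤ weight l a)
    (hg : ∀ s ∈ g.support, weight l s ≤ weight l b) :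
    ∀ s ∈ (f * g).support, weight l s ≤ weight l (a + b) := by
  classical
  intro s hs
  obtain ⟨x, hx, y, hy, rfl⟩ := Finset.mem_add.mp (support_mul f g hs)
  rw [weight_add, weight_add]
  exact add_le_add (hf x hx) (hg y hy)

theorem polyDerivation_X (A : Fin n → MvPolynomial (Fin n) ℂ) (i : Fin n) :
    polyDerivation A (X i) = A i := by
  simp [polyDerivation_apply, pderiv_X, Pi.single_apply]

theorem polyDerivation_C (A : Fin n → MvPolynomial (Fin n) ℂ) (c : ℂ) :
    polyDerivation A (C c) = 0 :=
  Derivation.map_algebraMap _ c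

theorem coeff_X_mul_pderiv (f : MvPolynomial (Fin n) ℂ) (i : Fin n) (a : Fin n →₀ ℕ) :
    coeff a (X i * pderiv i f) = a i * coeff a f := by
  classical
  rw [coeff_X_mul']
  split_ifs with h
  · have h1 : 1 ≤ a i := Nat.one_le_iff_ne_zero.mpr (Finsupp.mem_support_iff.mp h)
    rw [coeff_pderiv, tsub_add_cancel_of_le (Finsupp.single_le_iff.mpr h1), mul_comm]
    congr 1
    simp [Nat.cast_sub h1]
  · rw [Finsupp.notMem_support_iff.mp h]
    simp

section Nonresonant

variable {R : Fin n → MvPolynomial (Fin n) ℂ} {l : (Fin n → ℝ) →ₗ[ℝ] ℝ}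

/-- In `∑ R_i · X_i ∂_i` only the constant terms of the `R_i` can preserve the top weight, and each
`X_i ∂_i` multiplies `X^a` by `a i`. -/
theorem leading_polyDerivation (hR : ∀ i, ∀ s ∈ (R i).support, weight l s ≤ weight l 0)
    {f : MvPolynomial (Fin n) ℂ} {a : Fin n →₀ ℕ} (hf : ∀ s ∈ f.support, weight l s ≤ weight l a) :
    (∀ s ∈ (polyDerivation (fun i => X i * R i) f).support, weight l s ≤ weight l a) ∧
      coeff a (polyDerivation (fun i => X i * R i) f) = (∑ i, coeff 0 (R i) * a i) * coeff a f := by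
  have e : polyDerivation (fun i => X i * R i) f = ∑ i, R i * (X i * pderiv i f) := by
    rw [polyDerivation_apply]
    exact Finset.sum_congr rfl fun i _ => by ring
  have hsupp : ∀ i, ∀ s ∈ (X i * pderiv i f).support, weight l s ≤ weight l a := by
    intro i s hs
    rw [mem_support_iff, coeff_X_mul_pderiv] at hs
    exact hf s (mem_support_iff.mpr (right_ne_zero_of_mul hs))
  rw [e]
  constructor
  · intro s hs
    rw [mem_support_iff, coeff_sum] at hs
    obtain ⟨i, -, hi⟩ := Finset.exists_ne_zero_of_sum_ne_zero hs
    have := weight_le_of_mem_support_mul l (hR i) (hsupp i) s (mem_support_iff.mpr hi)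
    rwa [zero_add] at this
  · rw [coeff_sum, Finset.sum_mul]
    refine Finset.sum_congr rfl fun i _ => ?_
    have := coeff_mul_of_weight_le l (hR i) (hsupp i)
    rw [zero_add] at this
    rw [this, coeff_X_mul_pderiv]
    ring

/-- Comparing coefficients at `a + b` equates the eigenvalues of `X^a` and `X^b`; independence over
`ℤ` then gives `a = b`. -/
theorem leading_eq_of_proportional (hR : ∀ i, ∀ s ∈ (R i).support, weight l s ≤ weight l 0)
    (hμ : LinearIndependent ℤ fun i => coeff 0 (R i)) {P Q : MvPolynomial (Fin n) ℂ}
    (h : polyDerivation (fun i => X i * R i) P * Q = P * polyDerivation (fun i => X i * R i) Q)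
    {a b : Fin n →₀ ℕ} (ha : a ∈ P.support) (hb : b ∈ Q.support)
    (hP : ∀ s ∈ P.support, weight l s ≤ weight l a)
    (hQ : ∀ s ∈ Q.support, weight l s ≤ weight l b) : a = b := by
  obtain ⟨hP1, hP2⟩ := leading_polyDerivation hR hP
  obtain ⟨hQ1, hQ2⟩ := leading_polyDerivation hR hQ
  have h1 := congrArg (coeff (a + b)) h
  rw [coeff_mul_of_weight_le l hP1 hQ, coeff_mul_of_weight_le l hP hQ1, hP2, hQ2] at h1
  have ha0 := mem_support_iff.mp ha
  have hb0 := mem_support_iff.mp hb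
  have h2 : ∑ i, coeff 0 (R i) * (a i : ℂ) = ∑ i, coeff 0 (R i) * (b i : ℂ) := by
    apply mul_right_cancel₀ (mul_ne_zero ha0 hb0)
    linear_combination h1
  have h3 : ∑ i, ((a i : ℤ) - b i) • coeff 0 (R i) = 0 := by
    rw [← sub_eq_zero, ← Finset.sum_sub_distrib] at h2
    rw [← h2]
    refine Finset.sum_congr rfl fun i _ => ?_
    rw [zsmul_eq_mul]
    push_cast
    ring
  have h4 := Fintype.linearIndependent_iff.mp hμ _ h3
  ext i
  have := h4 i
  omega

theorem eq_C_mul_of_proportional (hR : ∀ i, ∀ s ∈ (R i).support, weight l s ≤ weight l 0)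
    (hμ : LinearIndependent ℤ fun i => coeff 0 (R i)) {P Q : MvPolynomial (Fin n) ℂ} (hQ : Q ≠ 0)
    (h : polyDerivation (fun i => X i * R i) P * Q = P * polyDerivation (fun i => X i * R i) Q) :
    ∃ c, P = C c * Q := by
  obtain ⟨b, hb, hbmax⟩ := exists_leading l hQ
  -- Subtracting this multiple of `Q` kills the coefficient at `b` and keeps the proportionality. A
  -- nonzero difference would have leading exponent `b`.
  refine ⟨coeff b P / coeff b Q, ?_⟩
  by_contra hne
  rw [← sub_eq_zero] at hne
  obtain ⟨a, ha, hamax⟩ := exists_leading l hne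
  have hab := leading_eq_of_proportional hR hμ
    (P := P - C (coeff b P / coeff b Q) * Q) (Q := Q) (by
      rw [map_sub, Derivation.leibniz, polyDerivation_C]
      simp only [smul_eq_mul]
      linear_combination h) ha hb hamax hbmax
  rw [hab, mem_support_iff, coeff_sub, coeff_C_mul, div_mul_cancel₀ _ (mem_support_iff.mp hb)] at ha
  exact ha (sub_self _)

end Nonresonant

/-! ### The extremal derivations -/

theorem coeff_aeval_X (r : Polynomial ℂ) (i : Fin n) (s : Fin n →₀ ℕ) :
    coeff s (Polynomial.aeval (X i : MvPolynomial (Fin n) ℂ) r) =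
      if s = Finsupp.single i (s i) then r.coeff (s i) else 0 := by
  classical
  induction r using Polynomial.induction_on' with
  | add p q hp hq =>
    rw [map_add, coeff_add, hp, hq]
    split_ifs <;> simp
  | monomial k c =>
    rw [Polynomial.aeval_monomial, algebraMap_eq, C_mul_X_pow_eq_monomial, coeff_monomial,
      Polynomial.coeff_monomial]
    by_cases h : s = Finsupp.single i (s i)
    · rw [if_pos h]
      congr 1
      rw [eq_iff_iff]
      constructor
      · rintro rfl; simp
      · intro hk; rw [hk, ← h]
    · rw [if_neg h, if_neg]
      rintro rfl
      simp at h

/-- The translation `X_0 ↦ X_0 + α`. -/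
noncomputable def translate [NeZero n] (α : ℂ) :
    MvPolynomial (Fin n) ℂ →ₐ[ℂ] MvPolynomial (Fin n) ℂ :=
  aeval fun i => if i = 0 then X 0 + C α else X i

theorem translate_X [NeZero n] (α : ℂ) (i : Fin n) :
    translate α (X i : MvPolynomial (Fin n) ℂ) = if i = 0 then X 0 + C α else X i := by
  rw [translate, aeval_X]

theorem translate_C [NeZero n] (α c : ℂ) :
    translate α (C c : MvPolynomial (Fin n) ℂ) = C c := by
  rw [translate, aeval_C, algebraMap_eq]

theorem translate_injective [NeZero n] (α : ℂ) : Function.Injective (translate (n := n) α) := by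
  have h : (translate (n := n) (-α)).comp (translate α) = AlgHom.id ℂ _ := by
    refine algHom_ext fun i => ?_
    rw [AlgHom.comp_apply, AlgHom.id_apply, translate_X]
    split_ifs with hi
    · rw [map_add, translate_X, translate_C, if_pos rfl, hi, add_assoc, ← C_add, neg_add_cancel,
        C_0, add_zero]
    · rw [translate_X, if_neg hi]
  intro x y hxy
  have hx := AlgHom.congr_fun h x
  have hy := AlgHom.congr_fun h y
  rw [AlgHom.comp_apply, AlgHom.id_apply] at hx hy
  rw [← hx, ← hy, hxy]

theorem translate_polyDerivation [NeZero n] (α : ℂ) {A B : Fin n → MvPolynomial (Fin n) ℂ}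
    (h : ∀ i, translate α (A i) = B i) (f : MvPolynomial (Fin n) ℂ) :
    translate α (polyDerivation A f) = polyDerivation B (translate α f) := by
  induction f using MvPolynomial.induction_on with
  | C a =>
    rw [polyDerivation_C, map_zero, translate_C, polyDerivation_C]
  | add p q hp hq => rw [map_add, map_add, map_add, map_add, hp, hq]
  | mul_X p i hp =>
    have hX : polyDerivation B (translate α (X i)) = B i := by
      rw [translate_X]
      split_ifs with hi
      · rw [map_add, polyDerivation_X, polyDerivation_C, add_zero, hi]
      · rw [polyDerivation_X]
    rw [Derivation.leibniz, map_mul, Derivation.leibniz, hX, polyDerivation_X]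
    simp only [smul_eq_mul, map_add, map_mul, hp, h]

theorem not_isRationalFirstIntegral_extremalField [NeZero n] {d : ℕ} {p : Polynomial ℂ} {α : ℂ}
    {ξ : Fin n → ℂ} (hp : IsExtremalData d p α ξ) (F : RatFun n) :
    ¬ IsRationalFirstIntegral (polyDerivation (extremalField p ξ)) F := by
  rintro ⟨hF, hDF⟩
  obtain ⟨P, Q, hQ, rfl⟩ := IsFractionRing.div_surjective (MvPolynomial (Fin n) ℂ) F
  have hQ0 := nonZeroDivisors.ne_zero hQ
  have hQ' : algebraMap _ (RatFun n) Q ≠ 0 := by simpa using hQ0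
  rw [extend_div _ _ _ hQ0, div_eq_zero_iff, or_iff_left (pow_ne_zero 2 hQ'),
    map_eq_zero_iff _ (IsFractionRing.injective _ _), sub_eq_zero] at hDF
  -- With `p = (X - α) q`, the translate of `p` is `X r`, where `r(0) = q(α) = p'(α)`.
  obtain ⟨q, hq⟩ := Polynomial.dvd_iff_isRoot.mpr hp.isRoot
  have hq' : p.derivative.eval α = q.eval α := by rw [hq]; simp
  set r : Polynomial ℂ := q.comp (Polynomial.X + Polynomial.C α) with hr
  let R : Fin n → MvPolynomial (Fin n) ℂ := fun i =>
    if i = 0 then Polynomial.aeval (X 0) r else C (ξ i)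
  have hAB : ∀ i, translate α (extremalField p ξ i) = X i * R i := by
    intro i
    by_cases hi : i = 0
    · subst hi
      simp only [extremalField, R, if_true]
      rw [← Polynomial.aeval_algHom_apply, translate_X, if_pos rfl, hq, hr, Polynomial.aeval_comp]
      simp
    · simp only [extremalField, R, if_neg hi, map_mul, translate_X]
      rw [translate_C, mul_comm]
  -- The sign makes lowest powers of `X 0` leading, so that `0` dominates the exponents of `r(X 0)`.
  let l : (Fin n → ℝ) →ₗ[ℝ] ℝ := -LinearMap.proj 0
  have hR : ∀ i, ∀ s ∈ (R i).support, weight l s ≤ weight l 0 := by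
    intro i s hs
    by_cases hs0 : s = 0
    · rw [hs0]
    apply weight_le_of_apply_lt
    rw [mem_support_iff] at hs
    by_cases hi : i = 0
    · simp only [R, if_pos hi, coeff_aeval_X] at hs
      have hs1 : s = Finsupp.single 0 (s 0) := by
        by_contra hc
        simp [hc] at hs
      have hs2 : 0 < s 0 := by
        rw [pos_iff_ne_zero]
        intro h0
        rw [h0, Finsupp.single_zero] at hs1
        exact hs0 hs1
      simpa [l, realVec, intVec] using hs2
    · simp only [R, if_neg hi, coeff_C] at hs
      simp [Ne.symm hs0] at hs
  have hμ : LinearIndependent ℤ fun i => coeff 0 (R i) := by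
    convert hp.indep using 2 with i
    by_cases hi : i = 0
    · simp only [R, if_pos hi]
      rw [coeff_aeval_X, hq']
      simp [hr, Polynomial.coeff_zero_eq_eval_zero, Polynomial.eval_comp]
    · simp [R, hi]
  have h1 := congrArg (translate α) hDF
  rw [map_mul, map_mul, translate_polyDerivation α hAB, translate_polyDerivation α hAB] at h1
  obtain ⟨c, hc⟩ := eq_C_mul_of_proportional hR hμ
    ((map_ne_zero_iff _ (translate_injective α)).mpr hQ0) h1
  have h2 : P = C c * Q := by
    apply translate_injective α
    rw [hc, map_mul, translate_C]
  apply hF c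
  rw [h2, map_mul, mul_div_cancel_right₀ _ hQ']

/-! ### Darboux polynomials of the extremal derivations -/

theorem not_X_sub_C_dvd {i j : Fin n} {a b : ℂ} (h : (i, a) ≠ (j, b)) :
    ¬ (X i - C a : MvPolynomial (Fin n) ℂ) ∣ X j - C b := by
  rintro ⟨g, hg⟩
  by_cases hij : i = j
  · subst hij
    have h1 := congrArg (eval fun _ => a) hg
    simp only [map_mul, map_sub, eval_X, eval_C, sub_self, zero_mul, sub_eq_zero] at h1
    exact h (by rw [h1])
  · have h1 := congrArg (eval (Function.update (fun _ => a) j (b + 1))) hg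
    simp [Function.update_of_ne hij] at h1

theorem irreducible_X_sub_C (i : Fin n) (a : ℂ) :
    Irreducible (X i - C a : MvPolynomial (Fin n) ℂ) := by
  have hc : coeff (Finsupp.single i 1) (X i - C a : MvPolynomial (Fin n) ℂ) = 1 := by
    classical
    have h : (0 : Fin n →₀ ℕ) ≠ Finsupp.single i 1 := fun h => by
      simpa using DFunLike.congr_fun h i
    rw [coeff_sub, coeff_C, if_neg h, sub_zero]
    simp
  refine irreducible_of_totalDegree_eq_one (le_antisymm ?_ ?_) fun x hx => ?_
  · exact (totalDegree_sub _ _).trans (by simp)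
  · have h1 := le_totalDegree (p := (X i - C a : MvPolynomial (Fin n) ℂ))
      (mem_support_iff.mpr (by rw [hc]; exact one_ne_zero))
    simpa using h1
  · exact isUnit_of_dvd_one (hc ▸ hx (Finsupp.single i 1))

/-- The pair `e k = (i, c)` encodes `X i - C c`: a linear factor of `p(X 0)` when `i = 0`, a
coordinate otherwise. -/
theorem isDarbouxFamily_X_sub_C [NeZero n] {p : Polynomial ℂ} {ξ : Fin n → ℂ} {m : ℕ}
    (e : Fin m → Fin n × ℂ) (he : Function.Injective e)
    (h : ∀ k, if (e k).1 = 0 then p.IsRoot (e k).2 else (e k).2 = 0) :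
    IsDarbouxFamily (polyDerivation (extremalField p ξ))
      fun k => (X (e k).1 - C (e k).2 : MvPolynomial (Fin n) ℂ) where
  darboux k := by
    have hk := h k
    rw [IsDarbouxPolynomial, map_sub, polyDerivation_X, polyDerivation_C, sub_zero]
    by_cases h0 : (e k).1 = 0
    · rw [if_pos h0] at hk
      obtain ⟨q, hq⟩ := Polynomial.dvd_iff_isRoot.mpr hk
      refine ⟨Polynomial.aeval (X 0) q, ?_⟩
      rw [extremalField, if_pos h0, h0]
      conv_lhs => rw [hq]
      simp [mul_comm]
    · rw [if_neg h0] at hk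
      exact ⟨C (ξ (e k).1), by rw [extremalField, if_neg h0, hk, C_0, sub_zero]⟩
  nonconstant k c hc := by
    have := congrArg (pderiv (e k).1) hc
    simp at this
  coprime i j hij := by
    rw [(irreducible_X_sub_C _ _).isRelPrime_iff_not_dvd]
    exact not_X_sub_C_dvd fun h => hij (he h)

theorem exists_isDarbouxFamily_extremalField [NeZero n] {d : ℕ} {p : Polynomial ℂ} {α : ℂ}
    {ξ : Fin n → ℂ} (hp : IsExtremalData d p α ξ) {m : ℕ} (hm : m = d + n - 1) :
    ∃ f : Fin m → MvPolynomial (Fin n) ℂ,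
      IsDarbouxFamily (polyDerivation (extremalField p ξ)) f ∧ ∀ i, Irreducible (f i) := by
  classical
  let I := {z // z ∈ p.roots.toFinset} ⊕ {i : Fin n // i ≠ 0}
  have hcard : Fintype.card I = m := by
    rw [Fintype.card_sum, Fintype.card_coe, hp.card_roots, Fintype.card_subtype_compl,
      Fintype.card_fin, Fintype.card_subtype_eq, hm]
    have := NeZero.pos n
    omega
  let e' : I → Fin n × ℂ := Sum.elim (fun z => (0, z.1)) fun i => (i.1, 0)
  have he' : Function.Injective e' := by
    rintro (⟨x, hx⟩ | ⟨i, hi⟩) (⟨y, hy⟩ | ⟨j, hj⟩) h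
    · exact congrArg Sum.inl (Subtype.ext (Prod.ext_iff.mp h).2)
    · exact absurd (Prod.ext_iff.mp h).1.symm hj
    · exact absurd (Prod.ext_iff.mp h).1 hi
    · exact congrArg Sum.inr (Subtype.ext (Prod.ext_iff.mp h).1)
  let σ := (Fintype.equivFinOfCardEq hcard).symm
  refine ⟨_, isDarbouxFamily_X_sub_C (fun k => e' (σ k)) (he'.comp σ.injective) fun k => ?_,
    fun k => irreducible_X_sub_C _ _⟩
  rcases hk : σ k with ⟨z, hz⟩ | ⟨i, hi⟩
  · simp only [e', Sum.elim_inl, if_true]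
    exact Polynomial.isRoot_of_mem_roots (Multiset.mem_toFinset.mp hz)
  · simp [e', hi]

/-! ### The Newton polytope of the extremal derivations -/

theorem exists_of_mem_latticeSupport {A : Fin n → MvPolynomial (Fin n) ℂ} {s : Fin n → ℤ}
    (hs : s ∈ latticeSupport A) :
    ∃ i, ∃ m ∈ (A i).support, s = intVec m + Pi.single i (-1) := by
  obtain ⟨i, hi⟩ := (mem_latticeSupport A s).mp hs
  have e : s = (s - Pi.single i (-1)) + Pi.single i (-1) := by abel
  rw [e, invX, AddMonoidAlgebra.coeff_mul_single_add, mul_one, (A i).as_sum, map_sum,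
    AddMonoidAlgebra.coeff_sum, Finsupp.finsetSum_apply] at hi
  obtain ⟨m, hm, hne⟩ := Finset.exists_ne_zero_of_sum_ne_zero hi
  rw [toLaurent_monomial, AddMonoidAlgebra.coeff_single, Finsupp.single_apply] at hne
  refine ⟨i, m, hm, ?_⟩
  have h1 : intVec m = s - Pi.single i (-1) := by
    by_contra hc
    simp [hc] at hne
  rw [h1, ← e]

theorem mem_latticeSupport_of_mem {A : Fin n → MvPolynomial (Fin n) ℂ} {i : Fin n}
    {m : Fin n →₀ ℕ} (hm : coeff m (A i) ≠ 0) :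
    intVec m + Pi.single i (-1) ∈ latticeSupport A := by
  rw [mem_latticeSupport]
  exact ⟨i, by rwa [coeff_toLaurent_mul_invX]⟩

section Extremal

variable [NeZero n] {d : ℕ} {p : Polynomial ℂ} {α : ℂ} {ξ : Fin n → ℂ}

theorem single_mem_latticeSupport {k : ℕ} (hk : p.coeff k ≠ 0) :
    (Pi.single 0 ((k : ℤ) - 1) : Fin n → ℤ) ∈ latticeSupport (extremalField p ξ) := by
  have h1 : coeff (Finsupp.single 0 k) (extremalField p ξ 0) ≠ 0 := by
    rw [extremalField, if_pos rfl, coeff_aeval_X]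
    simpa using hk
  convert mem_latticeSupport_of_mem h1 using 1
  ext j
  by_cases h : j = 0
  · subst h; simp [intVec]; ring
  · simp [intVec, h]

theorem IsExtremalData.natDegree_eq (hp : IsExtremalData d p α ξ) : p.natDegree = d :=
  Polynomial.natDegree_eq_of_degree_eq_some hp.degree_eq

/-- Otherwise `X²` divides `p`, against the simplicity of its roots. The Newton segment therefore
starts at `-1` or `0` and misses no natural point below `d`. -/
theorem IsExtremalData.coeff_ne_zero (hp : IsExtremalData d p α ξ) :
    p.coeff 0 ≠ 0 ∨ p.coeff 1 ≠ 0 := by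
  by_contra! hc
  have hp0 : p ≠ 0 := by
    rintro rfl
    have := hp.degree_eq
    simp at this
  have hdvd : (Polynomial.X - Polynomial.C 0) ^ 2 ∣ p := by
    rw [Polynomial.C_0, sub_zero, Polynomial.X_pow_dvd_iff]
    intro k hk
    interval_cases k
    · exact hc.1
    · exact hc.2
  rw [← Polynomial.le_rootMultiplicity_iff hp0, ← Polynomial.count_roots] at hdvd
  have hnodup : p.roots.Nodup := by
    rw [← Multiset.toFinset_card_eq_card_iff_nodup]
    apply le_antisymm (Multiset.toFinset_card_le _)
    rw [hp.card_roots, ← hp.natDegree_eq]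
    exact p.card_roots'
  have := Multiset.nodup_iff_count_le_one.mp hnodup 0
  omega

theorem extremal_mem_hull_iff (hd : 1 ≤ d) (hp : IsExtremalData d p α ξ) (m : Fin n → ℕ) :
    (fun i => (m i : ℝ)) ∈ convexHull ℝ
      (realVec '' (latticeSupport (extremalField p ξ) : Set (Fin n → ℤ))) ↔
      ∃ k < d, m = Pi.single 0 k := by
  constructor
  · intro h
    -- An upper bound on the first axis suffices, since `m` is natural. The terms with `i ≠ 0`
    -- contribute only the exponent `0`, which lies in `T` because `1 ≤ d`.
    let T : Set (Fin n → ℝ) := {x | x 0 ≤ (d : ℝ) - 1 ∧ ∀ i, i ≠ 0 → x i = 0}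
    have hT : Convex ℝ T := by
      intro x hx y hy a b ha hb hab
      refine ⟨?_, fun i hi => by simp [hx.2 i hi, hy.2 i hi]⟩
      have h1 := mul_le_mul_of_nonneg_left hx.1 ha
      have h2 := mul_le_mul_of_nonneg_left hy.1 hb
      have h3 : a * ((d : ℝ) - 1) + b * (d - 1) = d - 1 := by rw [← add_mul, hab, one_mul]
      simp only [Pi.add_apply, Pi.smul_apply, smul_eq_mul]
      linarith
    have hsub : realVec '' (latticeSupport (extremalField p ξ) : Set (Fin n → ℤ)) ⊆ T := by
      rintro _ ⟨s, hs, rfl⟩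
      obtain ⟨i, q, hq, rfl⟩ := exists_of_mem_latticeSupport hs
      rw [mem_support_iff] at hq
      by_cases hi : i = 0
      · subst hi
        rw [extremalField, if_pos rfl, coeff_aeval_X] at hq
        have hq1 : q = Finsupp.single 0 (q 0) := by
          by_contra hc
          simp [hc] at hq
        rw [if_pos hq1] at hq
        have hq2 := Polynomial.le_natDegree_of_ne_zero hq
        rw [hp.natDegree_eq] at hq2
        refine ⟨?_, fun j hj => ?_⟩
        · have : (q 0 : ℝ) ≤ d := by exact_mod_cast hq2
          simp only [realVec, intVec, Pi.add_apply, Pi.single_eq_same]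
          push_cast
          linarith
        · rw [hq1]
          simp [realVec, intVec, hj]
      · classical
        rw [extremalField, if_neg hi, coeff_C_mul, coeff_X] at hq
        have hq1 : Finsupp.single i 1 = q := by
          by_contra hc
          simp [hc] at hq
        have hz : intVec q + Pi.single i (-1) = 0 := by
          rw [← hq1]
          ext j
          by_cases hj : j = i
          · subst hj; simp [intVec]
          · simp [intVec, hj]
        rw [hz]
        have : (1 : ℝ) ≤ d := by exact_mod_cast hd
        exact ⟨by simpa [realVec] using this, fun j _ => by simp [realVec]⟩
    obtain ⟨h0, h1⟩ := convexHull_min hsub hT h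
    refine ⟨m 0, ?_, ?_⟩
    · have : (m 0 : ℝ) + 1 ≤ d := by linarith
      exact_mod_cast this
    · ext i
      by_cases hi : i = 0
      · subst hi; simp
      · have := h1 i hi
        simpa [hi] using this
  · rintro ⟨k, hk, rfl⟩
    set H := convexHull ℝ (realVec '' (latticeSupport (extremalField p ξ) : Set (Fin n → ℤ)))
    -- On the first axis, the hull contains `-1` or `0`, and also `d - 1`; convexity supplies every
    -- `k` between.
    have hconv : Convex ℝ ((LinearMap.single ℝ (fun _ : Fin n => ℝ) 0) ⁻¹' H) :=
      (convex_convexHull ℝ _).linear_preimage _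
    have hmem : ∀ j : ℕ, p.coeff j ≠ 0 →
        ((j : ℝ) - 1) ∈ (LinearMap.single ℝ (fun _ : Fin n => ℝ) 0) ⁻¹' H := by
      intro j hj
      refine subset_convexHull ℝ _ ⟨_, single_mem_latticeSupport (ξ := ξ) hj, ?_⟩
      ext i
      by_cases hi : i = 0
      · subst hi; simp [realVec]
      · simp [realVec, hi]
    have htop : p.coeff d ≠ 0 := by
      rw [← hp.natDegree_eq]
      apply Polynomial.leadingCoeff_ne_zero.mpr
      rintro rfl
      have := hp.degree_eq
      simp at this
    have hk1 : (k : ℝ) ≤ (d : ℝ) - 1 := by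
      have : (k : ℝ) + 1 ≤ d := by exact_mod_cast hk
      linarith
    have hk0 : (0 : ℝ) ≤ k := Nat.cast_nonneg k
    have hkm : (k : ℝ) ∈ (LinearMap.single ℝ (fun _ : Fin n => ℝ) 0) ⁻¹' H := by
      rcases hp.coeff_ne_zero with h | h
      · exact hconv.ordConnected.out (hmem 0 h) (hmem d htop) ⟨by push_cast; linarith, hk1⟩
      · exact hconv.ordConnected.out (hmem 1 h) (hmem d htop) ⟨by push_cast; linarith, hk1⟩
    have e : (fun i => ((Pi.single 0 k : Fin n → ℕ) i : ℝ)) =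
        LinearMap.single ℝ (fun _ : Fin n => ℝ) 0 (k : ℝ) := by
      ext i
      by_cases hi : i = 0
      · subst hi; simp
      · simp [hi]
    rw [e]
    exact hkm

theorem natPointCount_extremalField (hd : 1 ≤ d) (hp : IsExtremalData d p α ξ) :
    natPointCount (convexHull ℝ
      (realVec '' (latticeSupport (extremalField p ξ) : Set (Fin n → ℤ)))) = d := by
  classical
  have e : {m : Fin n → ℕ | (fun i => (m i : ℝ)) ∈ convexHull ℝ
      (realVec '' (latticeSupport (extremalField p ξ) : Set (Fin n → ℤ)))} =
      ((Finset.range d).image fun k => (Pi.single 0 k : Fin n → ℕ) : Finset (Fin n → ℕ)) := by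
    ext m
    rw [Set.mem_ofPred_eq, extremal_mem_hull_iff hd hp]
    simp [eq_comm]
  rw [natPointCount, e, Set.ncard_coe_finset, Finset.card_image_of_injective, Finset.card_range]
  exact Pi.single_injective (M := fun _ : Fin n => ℕ) 0

end Extremal

theorem exists_isExtremalData [NeZero n] {d : ℕ} (hd : 1 ≤ d) :
    ∃ (p : Polynomial ℂ) (α : ℂ) (ξ : Fin n → ℂ), IsExtremalData d p α ξ := by
  obtain ⟨z, hz⟩ : ∃ z : Fin n → ℂ, LinearIndependent ℤ z := by
    -- `ℂ` has infinite dimension over `ℚ`, and independence over `ℚ` and over `ℤ` coincide.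
    let b := Module.Basis.ofVectorSpace ℚ ℂ
    have hinf : Infinite (Module.Basis.ofVectorSpaceIndex ℚ ℂ) := by
      rw [Cardinal.infinite_iff, b.mk_eq_rank'', Complex.rank_rat_complex]
      exact Cardinal.aleph0_le_continuum
    refine ⟨fun i => b (Infinite.natEmbedding _ i), ?_⟩
    rw [LinearIndependent.iff_fractionRing ℤ ℚ]
    exact b.linearIndependent.comp (fun i : Fin n => Infinite.natEmbedding _ (i : ℕ))
      ((Infinite.natEmbedding _).injective.comp Fin.val_injective)
  have hz0 : z 0 ≠ 0 := hz.ne_zero 0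
  have hd0 : (d : ℂ) ≠ 0 := by exact_mod_cast (by omega : d ≠ 0)
  have hc : z 0 / d ≠ 0 := div_ne_zero hz0 hd0
  -- The roots are the `d`-th roots of unity, and the factor `z 0 / d` makes `p'(1) = z 0`.
  refine ⟨Polynomial.C (z 0 / d) * (Polynomial.X ^ d - Polynomial.C 1), 1, z, ?_, ?_, ?_, ?_⟩
  · rw [Polynomial.degree_C_mul hc, Polynomial.degree_X_pow_sub_C (by omega)]
  · rw [Polynomial.roots_C_mul _ hc]
    have := (Complex.isPrimitiveRoot_exp d (by omega)).card_nthRootsFinset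
    rwa [Polynomial.nthRootsFinset_def, Polynomial.nthRoots] at this
  · simp
  · convert hz using 2 with i
    split_ifs with hi
    · simp [hi, hd0, Polynomial.derivative_X_pow]
    · rfl

end SparseDarboux

theorem mainTheorem1 (n : ℕ) [NeZero n] :
    (∀ A : Fin n → MvPolynomial (Fin n) ℂ, ∃ N : Set (Fin n → ℝ),
      SparseDarboux.IsGenericNewtonPolytope A N ∧
      (∀ (m : ℕ) (f : Fin m → MvPolynomial (Fin n) ℂ),
        SparseDarboux.IsDarbouxFamily (SparseDarboux.polyDerivation A) f →
        SparseDarboux.natPointCount N + 1 ≤ m →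
        ∃ lam : Fin m → ℂ, SparseDarboux.IsDarbouxFirstIntegral A f lam) ∧
      (∀ (m : ℕ) (f : Fin m → MvPolynomial (Fin n) ℂ),
        SparseDarboux.IsDarbouxFamily (SparseDarboux.polyDerivation A) f →
        SparseDarboux.natPointCount N + n ≤ m →
        ∃ F : SparseDarboux.RatFun n,
          SparseDarboux.IsRationalFirstIntegral (SparseDarboux.polyDerivation A) F)) ∧
    (∀ d : ℕ, 1 ≤ d →
      (∃ (p : Polynomial ℂ) (α : ℂ) (ξ : Fin n → ℂ), SparseDarboux.IsExtremalData d p α ξ) ∧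
      ∀ (p : Polynomial ℂ) (α : ℂ) (ξ : Fin n → ℂ), SparseDarboux.IsExtremalData d p α ξ →
        ∃ N : Set (Fin n → ℝ),
          SparseDarboux.IsGenericNewtonPolytope (SparseDarboux.extremalField p ξ) N ∧
          SparseDarboux.natPointCount N = d ∧
          (∃ f : Fin (SparseDarboux.natPointCount N + n - 1) → MvPolynomial (Fin n) ℂ,
            SparseDarboux.IsDarbouxFamily
              (SparseDarboux.polyDerivation (SparseDarboux.extremalField p ξ)) f ∧
            ∀ i, Irreducible (f i)) ∧
          ¬ ∃ F : SparseDarboux.RatFun n,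
            SparseDarboux.IsRationalFirstIntegral
              (SparseDarboux.polyDerivation (SparseDarboux.extremalField p ξ)) F) := by
  refine ⟨fun A => ⟨_, SparseDarboux.isGenericNewtonPolytope_latticeSupport A, ?_, ?_⟩,
    fun d hd => ⟨SparseDarboux.exists_isExtremalData hd, fun p α ξ hp =>
      ⟨_, SparseDarboux.isGenericNewtonPolytope_latticeSupport _,
        SparseDarboux.natPointCount_extremalField hd hp,
        SparseDarboux.exists_isDarbouxFamily_extremalField hp
          (by rw [SparseDarboux.natPointCount_extremalField hd hp]),
        fun ⟨F, hF⟩ => SparseDarboux.not_isRationalFirstIntegral_extremalField hp F hF⟩⟩⟩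
  · intro m f hf hm
    choose g hg using hf.darboux
    have hr := SparseDarboux.le_finrank_ker_relationMap
      (SparseDarboux.finite_cofactorExponents (SparseDarboux.latticeSupport A))
      (fun i q hq => SparseDarboux.cofactor_support A (hf.ne_zero i) (hg i) hq) hm
    have : Nontrivial (LinearMap.ker (SparseDarboux.relationMap g)) :=
      Module.nontrivial_of_finrank_pos hr
    obtain ⟨lam, hlam⟩ := exists_ne (0 : LinearMap.ker (SparseDarboux.relationMap g))
    exact ⟨lam, SparseDarboux.isDarbouxFirstIntegral_of_relation hf hg
      (fun h => hlam (Subtype.ext h)) lam.2⟩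
  · intro m f hf hm
    choose g hg using hf.darboux
    by_cases hA : A = 0
    · exact SparseDarboux.exists_isRationalFirstIntegral_of_eq_zero hA hf
        ((Nat.add_pos_right _ (NeZero.pos n)).trans_le hm)
    · exact SparseDarboux.exists_isRationalFirstIntegral hA hf hg
        (SparseDarboux.le_finrank_ker_relationMap
          (SparseDarboux.finite_cofactorExponents (SparseDarboux.latticeSupport A))
          (fun i q hq => SparseDarboux.cofactor_support A (hf.ne_zero i) (hg i) hq) hm)
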